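/- Let $V$ be a closed isometric linear operator in a complex Hilbert space $H$, with domain $D(V)\subseteq H$ (not necessarily dense) and range in $H$, and let $E$ be the identity operator. Let $\mathbb D=\{|z|<1\}$, $\mathbb D_e=\{|z|>1\}$, $\mathbb T=\{|z|=1\}$. A generalized resolvent of $V$ is an operator-valued function of the form $\mathbf R_z h=P_H(E_{\widetilde H}-zU)^{-1}h$ ($h\in H$, $|z|\ne1$), where $U\supseteq V$ is a unitary operator in a Hilbert space $\widetilde H\supseteq H$ and $P_H$ is the orthogonal projection of $\widetilde H$ onto $H$. For $\zeta\in\mathbb C$ put $M_\zeta=(E-\zeta V)D(V)$ and $N_\zeta=H\ominus M_\zeta$. Fix $z_0\in\mathbb D\setminus\{0\}$ and let $V_{z_0}=(V-\overline{z_0}E)(E-z_0V)^{-1}$, an isometric operator with domain $M_{z_0}$. For a linear contraction $C:N_{z_0}\to N_{1/\overline{z_0}}$ put $V^+_{z_0;C}=V_{z_0}\oplus C$ on $H=M_{z_0}\oplus N_{z_0}$ and $$V_{C;z_0}=(V^+_{z_0;C}+\overline{z_0}E)(E+z_0V^+_{z_0;C})^{-1}.$$ Let $\mathbf R_z$ be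 an arbitrary generalized resolvent of $V$, and let $C(\lambda;z_0)$ correspond to it by Inin's formula, that is, let it be an analytic function of $\lambda\in\mathbb D$ whose values are linear contractions from $N_{z_0}$ into $N_{1/\overline{z_0}}$, such that $$\mathbf R_\lambda=\left[E-\lambda V_{C(\lambda;z_0);z_0}\right]^{-1},\qquad \lambda\in\mathbb D.$$ Let $\Delta$ be an open arc of $\mathbb T$. Then $\mathbf R_z$ has an analytic continuation to $\mathbb D\cup\mathbb D_e\cup\Delta$ if and only if the following conditions are satisfied: 1. $C(\lambda;z_0)$ has an extension to $\mathbb D\cup\Delta$ which is continuous in the uniform operator topology; 2. the extended $C(\lambda;z_0)$ maps $N_{z_0}$ isometrically onto the whole of $N_{1/\overline{z_0}}$ for all $\lambda\in\Delta$; 3. the operator $(E-\lambda V_{C(\lambda;z_0);z_0})^{-1}$ exists and is defined on the whole of $H$ for all $\lambda\in\Delta$. -/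

import Mathlib

open Complex Metric Set
open scoped ComplexConjugate

universe u v

noncomputable section

namespace GenRes

variable {H : Type u} [NormedAddCommGroup H] [InnerProductSpace ℂ H]

/-- `V` is a closed isometric operator in `H`; its domain `D(V)` is a linear manifold of `H` that
need not be dense. -/
structure IsClosedIsometric (V : H →ₗ.[ℂ] H) : Prop where
  closed : V.IsClosed
  isometric : ∀ x : V.domain, ‖V x‖ = ‖(x : H)‖

/-- The operator `E - z V`, defined on `D(V)`. -/
def idSub (V : H →ₗ.[ℂ] H) (z : ℂ) : V.domain →ₗ[ℂ] H :=
  V.domain.subtype - z • V.toFun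

/-- `M_z = (E - z V) D(V)`. -/
def M (V : H →ₗ.[ℂ] H) (z : ℂ) : Submodule ℂ H := LinearMap.range (idSub V z)

/-- The defect subspace `N_z = H ⊖ M_z`. -/
def N (V : H →ₗ.[ℂ] H) (z : ℂ) : Submodule ℂ H := (M V z)ᗮ

theorem idSub_apply (V : H →ₗ.[ℂ] H) (z : ℂ) (x : V.domain) :
    idSub V z x = (x : H) - z • V x := rfl

theorem le_norm_idSub {V : H →ₗ.[ℂ] H} (hV : IsClosedIsometric V) (z : ℂ) (x : V.domain) :
    (1 - ‖z‖) * ‖(x : H)‖ ≤ ‖idSub V z x‖ := by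
  have h := norm_sub_norm_le (x : H) (z • V x)
  rw [norm_smul, hV.isometric] at h
  rw [idSub_apply]
  linarith

theorem idSub_injective {V : H →ₗ.[ℂ] H} (hV : IsClosedIsometric V) {z : ℂ} (hz : ‖z‖ < 1) :
    Function.Injective (idSub V z) := by
  rw [← LinearMap.ker_eq_bot, LinearMap.ker_eq_bot']
  intro x hx
  have h := le_norm_idSub hV z x
  rw [hx, norm_zero] at h
  have h0 : ‖(x : H)‖ ≤ 0 := by
    by_contra hne
    push Not at hne
    nlinarith
  exact Subtype.ext (norm_le_zero_iff.mp h0)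

theorem norm_cayley_eq {V : H →ₗ.[ℂ] H} (hV : IsClosedIsometric V) (z : ℂ) (x : V.domain) :
    ‖V x - conj z • (x : H)‖ = ‖idSub V z x‖ := by
  have h1 := @norm_sub_sq ℂ H _ _ _ (V x) (conj z • (x : H))
  have h2 := @norm_sub_sq ℂ H _ _ _ (x : H) (z • V x)
  rw [idSub_apply]
  have h3 : RCLike.re (inner ℂ (V x) (conj z • (x : H)))
      = RCLike.re (inner ℂ (x : H) (z • V x)) := by
    rw [inner_smul_right, inner_smul_right, ← inner_conj_symm (V x) (x : H), ← map_mul,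
      RCLike.conj_re]
  rw [h3, norm_smul, hV.isometric x, RCLike.norm_conj] at h1
  rw [norm_smul, hV.isometric x] at h2
  have h4 : ‖V x - conj z • (x : H)‖ ^ 2 = ‖(x : H) - z • V x‖ ^ 2 := by rw [h1, h2]
  exact (sq_eq_sq₀ (norm_nonneg _) (norm_nonneg _)).mp h4

/-- The inverse `(E - z V)⁻¹ : M_z → D(V)` for `|z| < 1`. -/
def idSubInv {V : H →ₗ.[ℂ] H} (hV : IsClosedIsometric V) {z : ℂ} (hz : ‖z‖ < 1) :
    M V z ≃ₗ[ℂ] V.domain :=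
  (LinearEquiv.ofInjective (idSub V z) (idSub_injective hV hz)).symm

/-- The isometric operator `V_z = (V - z̄ E)(E - z V)⁻¹` with domain `M_z`, for `|z| < 1`. -/
def Vz {V : H →ₗ.[ℂ] H} (hV : IsClosedIsometric V) {z : ℂ} (hz : ‖z‖ < 1) : M V z →ₗᵢ[ℂ] H where
  toLinearMap := (V.toFun - conj z • V.domain.subtype) ∘ₗ (idSubInv hV hz).toLinearMap
  norm_map' := by
    intro y
    obtain ⟨x, rfl⟩ := (idSubInv hV hz).symm.surjective y
    have h : (((idSubInv hV hz).symm x : M V z) : H) = idSub V z x := rfl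
    rw [← Submodule.norm_coe, h]
    simpa using norm_cayley_eq hV z x

variable [CompleteSpace H]

theorem isClosed_M {V : H →ₗ.[ℂ] H} (hV : IsClosedIsometric V) {z : ℂ} (hz : ‖z‖ < 1) :
    IsClosed (M V z : Set H) := by
  have hg : IsClosed (V.graph : Set (H × H)) := hV.closed
  have : CompleteSpace V.graph := hg.completeSpace_coe
  let f : V.graph →L[ℂ] H := ((ContinuousLinearMap.fst ℂ H H) -
    z • (ContinuousLinearMap.snd ℂ H H)).comp V.graph.subtypeL
  have hf : ∀ p : V.graph, ∃ x : V.domain, (p : H × H) = ((x : H), V x) := by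
    intro p
    obtain ⟨x, hx1, hx2⟩ := (LinearPMap.mem_graph_iff V).mp p.2
    exact ⟨x, Prod.ext hx1.symm hx2.symm⟩
  have hanti : AntilipschitzWith (Real.toNNReal (1 - ‖z‖)⁻¹) f := by
    apply ContinuousLinearMap.antilipschitz_of_bound
    intro p
    obtain ⟨x, hx⟩ := hf p
    have h := le_norm_idSub hV z x
    have hfx : f p = idSub V z x := by
      simp [f, hx, idSub_apply]
    have hp : ‖p‖ = ‖(x : H)‖ := by
      rw [← Submodule.norm_coe, hx, Prod.norm_def]
      simp [hV.isometric x]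
    have hpos : 0 < 1 - ‖z‖ := by linarith
    rw [hfx, hp, Real.coe_toNNReal _ (inv_nonneg.mpr hpos.le), inv_mul_eq_div, le_div_iff₀ hpos]
    linarith
  have hr : (M V z : Set H) = Set.range f := by
    ext y
    constructor
    · rintro ⟨x, rfl⟩
      exact ⟨⟨((x : H), V x), V.mem_graph x⟩, by simp [f, idSub_apply]⟩
    · rintro ⟨p, rfl⟩
      obtain ⟨x, hx⟩ := hf p
      exact ⟨x, by simp [f, hx, idSub_apply]⟩
  rw [hr]
  exact hanti.isClosed_range f.uniformContinuous

theorem hasOrthogonalProjection_M {V : H →ₗ.[ℂ] H} (hV : IsClosedIsometric V) {z : ℂ}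
    (hz : ‖z‖ < 1) : (M V z).HasOrthogonalProjection := by
  have := (isClosed_M hV hz).completeSpace_coe
  infer_instance

instance (V : H →ₗ.[ℂ] H) (z : ℂ) : (N V z).HasOrthogonalProjection :=
  inferInstanceAs ((M V z)ᗮ).HasOrthogonalProjection

/-- The orthogonal sum `V⁺_{z;C} = V_z ⊕ C`, acting on the whole of `H = M_z ⊕ N_z`, where
`C : N_z → N_{1/z̄}` is a bounded operator and `0 < |z| < 1`. -/
def Vplus {V : H →ₗ.[ℂ] H} (hV : IsClosedIsometric V) {z : ℂ} (hz : ‖z‖ < 1)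
    (C : N V z →L[ℂ] N V (conj z)⁻¹) : H →L[ℂ] H :=
  haveI := hasOrthogonalProjection_M hV hz
  (Vz hV hz).toContinuousLinearMap ∘L (M V z).orthogonalProjectionOnto
    + (N V (conj z)⁻¹).subtypeL ∘L C ∘L (N V z).orthogonalProjectionOnto

/-- The orthogonal extension `V_{C;z} = (V⁺_{z;C} + z̄ E)(E + z V⁺_{z;C})⁻¹` of `V` defined by `C`.
The inverse exists as a bounded operator on `H` whenever `C` is a contraction. -/
def VC {V : H →ₗ.[ℂ] H} (hV : IsClosedIsometric V) {z : ℂ} (hz : ‖z‖ < 1)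
    (C : N V z →L[ℂ] N V (conj z)⁻¹) : H →L[ℂ] H :=
  (Vplus hV hz C + conj z • (1 : H →L[ℂ] H)) * Ring.inverse (1 + z • Vplus hV hz C)

/-- The class `𝒮(H₁; H₂)`: operator-valued functions analytic in the open unit disc whose values
are linear contractions from `H₁` into `H₂`. Values outside the disc are irrelevant. -/
structure IsSchur (H₁ H₂ : Submodule ℂ H) (F : ℂ → (H₁ →L[ℂ] H₂)) : Prop where
  analytic : AnalyticOnNhd ℂ F (ball 0 1)
  contraction : ∀ ζ ∈ ball (0 : ℂ) 1, ‖F ζ‖ ≤ 1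

/-- `R` is a generalized resolvent of `V`: there are a Hilbert space `K ⊇ H` (with embedding `ι`)
and a unitary operator `U ⊇ V` in `K` with `R_ζ h = P (E - ζ U)⁻¹ h` for `h ∈ H` and `|ζ| ≠ 1`.
The orthogonal projection of `K` onto `H` is the adjoint of the embedding. Values of `R` on the
unit circle are irrelevant. -/
def IsGeneralizedResolvent (V : H →ₗ.[ℂ] H) (R : ℂ → (H →L[ℂ] H)) : Prop :=
  ∃ (K : Type v) (_ : NormedAddCommGroup K) (_ : InnerProductSpace ℂ K) (_ : CompleteSpace K)
    (ι : H →ₗᵢ[ℂ] K) (U : K →L[ℂ] K),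
    U ∈ unitary (K →L[ℂ] K) ∧
    (∀ x : V.domain, U (ι x) = ι (V x)) ∧
    ∀ ζ : ℂ, ‖ζ‖ ≠ 1 →
      R ζ = (ContinuousLinearMap.adjoint ι.toContinuousLinearMap) ∘L
        (Ring.inverse (1 - ζ • U)) ∘L ι.toContinuousLinearMap

/-- `C ∈ 𝒮(N_z; N_{1/z̄})` corresponds to `R` by Inin's formula: `R_ζ` is the two-sided inverse of
`E - ζ V_{C(ζ);z}` for all `|ζ| < 1`. -/
structure IninCorresponds {V : H →ₗ.[ℂ] H} (hV : IsClosedIsometric V) {z : ℂ} (hz : ‖z‖ < 1)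
    (R : ℂ → (H →L[ℂ] H)) (C : ℂ → (N V z →L[ℂ] N V (conj z)⁻¹)) : Prop where
  schur : IsSchur (N V z) (N V (conj z)⁻¹) C
  right_inv : ∀ ζ ∈ ball (0 : ℂ) 1, (1 - ζ • VC hV hz (C ζ)) * R ζ = 1
  left_inv : ∀ ζ ∈ ball (0 : ℂ) 1, R ζ * (1 - ζ • VC hV hz (C ζ)) = 1

/-- `Δ` is a (non-empty) open arc of the unit circle; the whole circle is allowed. -/
def IsOpenArc (Δ : Set ℂ) : Prop :=
  ∃ a b : ℝ, a < b ∧ Δ = (fun θ : ℝ => Complex.exp (θ * I)) '' Ioo a b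

/-- `R`, given for `|z| ≠ 1`, has an analytic continuation (in the operator norm) to
`𝔻 ∪ 𝔻_e ∪ Δ`. -/
def HasAnalyticContinuation (R : ℂ → (H →L[ℂ] H)) (Δ : Set ℂ) : Prop :=
  ∃ T : ℂ → (H →L[ℂ] H),
    AnalyticOnNhd ℂ T ({z | ‖z‖ < 1} ∪ {z | 1 < ‖z‖} ∪ Δ) ∧ ∀ z : ℂ, ‖z‖ ≠ 1 → T z = R z

end GenRes

end

/-!
A generalized resolvent satisfies the symmetry `R(ζ)* + R(1/ζ̄) = 1` off the unit circle, and Inin's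
formula exhibits `V⁺_{z₀;C(ζ)}` as a fractional linear function `num / den` of `R(ζ)`.

If `R` continues across a point `ζ` of the circle, the boundary value `L` satisfies `L* + L = 1`.
Then `den` is normal and invertible, because the spectrum of `L` lies on the line `Re w = 1/2`, and
`num = -ζ den*`; so `V⁺_{z₀;C(·)}` converges to a unitary operator. Since `C ↦ V⁺_{z₀;C}` is a
closed embedding, `C(·)` converges too, and its limit is isometric and onto.

Conversely, under the three conditions the boundary values `G` of `R` satisfy `G* + G = 1`, so the
reflection `1 - G(1/ζ̄)*` continues `R` continuously across the arc, and by Painlevé's theorem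
the continuation is analytic.
-/

namespace GenRes

open Filter Topology

section Painleve

variable {E : Type*} [NormedAddCommGroup E] [NormedSpace ℂ E] {f : ℂ → E} {U : Set ℂ}

theorem wedgeIntegral_add_wedgeIntegral_eq_zero {z w : ℂ}
    (hc : ContinuousOn f (uIcc z.re w.re ×ℂ uIcc z.im w.im))
    (hd : ∀ u ∈ uIcc z.re w.re ×ℂ uIcc z.im w.im, u.im ≠ 0 → DifferentiableAt ℂ f u)
    (h0 : (0 : ℝ) ∉ Ioo (min z.im w.im) (max z.im w.im)) :
    wedgeIntegral z w f + wedgeIntegral w z f = 0 := by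
  rw [wedgeIntegral_add_wedgeIntegral_eq]
  refine integral_boundary_rect_eq_zero_of_continuousOn_of_differentiableOn f z w hc
    fun u ⟨hre, him⟩ => (hd u ?_ fun h => h0 (h ▸ him)).differentiableWithinAt
  exact ⟨Ioo_subset_Icc_self hre, Ioo_subset_Icc_self him⟩

theorem wedgeIntegral_add_wedgeIntegral_split {z w : ℂ}
    (hc : ContinuousOn f (uIcc z.re w.re ×ℂ uIcc z.im w.im)) {c : ℝ} (hcz : c ∈ uIcc z.im w.im) :
    wedgeIntegral z w f + wedgeIntegral w z f =
      (wedgeIntegral z (w.re + c * I) f + wedgeIntegral (w.re + c * I) z f) +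
        (wedgeIntegral (z.re + c * I) w f + wedgeIntegral w (z.re + c * I) f) := by
  have hint : ∀ x ∈ uIcc z.re w.re, ∀ a ∈ uIcc z.im w.im, ∀ b ∈ uIcc z.im w.im,
      IntervalIntegrable (fun y : ℝ => f (x + y * I)) MeasureTheory.volume a b := by
    intro x hx a ha b hb
    refine ContinuousOn.intervalIntegrable (hc.comp (by fun_prop) fun y hy => ?_)
    exact mem_reProdIm.mpr ⟨by simpa using hx, by simpa using uIcc_subset_uIcc ha hb hy⟩
  simp only [wedgeIntegral_add_wedgeIntegral_eq, add_re, add_im, ofReal_re, ofReal_im, mul_re,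
    mul_im, I_re, I_im, mul_zero, mul_one, sub_zero, add_zero, zero_add]
  rw [← intervalIntegral.integral_add_adjacent_intervals
      (hint _ right_mem_uIcc _ left_mem_uIcc _ hcz) (hint _ right_mem_uIcc _ hcz _ right_mem_uIcc),
    ← intervalIntegral.integral_add_adjacent_intervals
      (hint _ left_mem_uIcc _ left_mem_uIcc _ hcz) (hint _ left_mem_uIcc _ hcz _ right_mem_uIcc)]
  simp only [smul_add]
  abel

theorem differentiableOn_of_differentiableAt_off_real [CompleteSpace E] (hU : IsOpen U)
    (hc : ContinuousOn f U) (hd : ∀ w ∈ U, w.im ≠ 0 → DifferentiableAt ℂ f w) :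
    DifferentiableOn ℂ f U := by
  refine (isConservativeOn_and_continuousOn_iff_isDifferentiableOn hU).mp ⟨fun z w hzw => ?_, hc⟩
  rw [← add_eq_zero_iff_eq_neg]
  have hzero : ∀ p q : ℂ, uIcc p.re q.re ×ℂ uIcc p.im q.im ⊆ uIcc z.re w.re ×ℂ uIcc z.im w.im →
      (0 : ℝ) ∉ Ioo (min p.im q.im) (max p.im q.im) →
      wedgeIntegral p q f + wedgeIntegral q p f = 0 := fun p q hpq =>
    wedgeIntegral_add_wedgeIntegral_eq_zero (hc.mono (hpq.trans hzw))
      fun u hu => hd u (hzw (hpq hu))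
  by_cases h0 : (0 : ℝ) ∈ uIcc z.im w.im
  · rw [wedgeIntegral_add_wedgeIntegral_split (hc.mono hzw) h0, hzero, hzero, add_zero]
    · exact reProdIm_subset_iff'.mpr
        (Or.inl ⟨by simp, by simpa using uIcc_subset_uIcc h0 right_mem_uIcc⟩)
    · simp +contextual [le_of_lt]
    · exact reProdIm_subset_iff'.mpr
        (Or.inl ⟨by simp, by simpa using uIcc_subset_uIcc left_mem_uIcc h0⟩)
    · simp +contextual [le_of_lt]
  · exact hzero z w Subset.rfl fun h => h0 (Ioo_subset_Icc_self h)

theorem differentiableOn_of_differentiableAt_off_circle [CompleteSpace E] (hU : IsOpen U)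
    (hc : ContinuousOn f U) (hd : ∀ w ∈ U, ‖w‖ ≠ 1 → DifferentiableAt ℂ f w) :
    DifferentiableOn ℂ f U := by
  intro ζ hζ
  by_cases hζ1 : ‖ζ‖ = 1
  swap
  · exact (hd ζ hζ hζ1).differentiableWithinAt
  have hζ0 : ζ ≠ 0 := norm_ne_zero_iff.mp (hζ1 ▸ one_ne_zero)
  -- This chart straightens the circle near `ζ` to the real line.
  let e : ℂ → ℂ := fun w => ζ * exp (w * I)
  have he : Continuous e := by fun_prop
  have hlift : DifferentiableOn ℂ (f ∘ e) (e ⁻¹' U) := by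
    refine differentiableOn_of_differentiableAt_off_real (hU.preimage he)
      (hc.comp he.continuousOn (mapsTo_preimage e U)) fun w hw him => ?_
    refine (hd (e w) hw ?_).comp w (by fun_prop)
    simpa [e, hζ1, norm_exp, Real.exp_eq_one_iff] using him
  let l : ℂ → ℂ := fun w => log (w / ζ) / I
  have hlζ : l ζ = 0 := by simp [l, hζ0]
  have hl : DifferentiableAt ℂ l ζ := by
    refine ((differentiableAt_id.div_const ζ).clog ?_).div_const I
    simp [hζ0]
  have hel : ∀ᶠ w in 𝓝 ζ, e (l w) = w := by
    filter_upwards [isOpen_ne.mem_nhds hζ0] with w hw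
    simp only [e, l, div_mul_cancel₀ _ I_ne_zero]
    rw [exp_log (div_ne_zero hw hζ0), mul_div_cancel₀ _ hζ0]
  have hcomp : DifferentiableAt ℂ (f ∘ e ∘ l) ζ := by
    refine DifferentiableAt.comp ζ (g := f ∘ e) ?_ hl
    refine hlift.differentiableAt ((hU.preimage he).mem_nhds ?_)
    simpa [hlζ, e] using hζ
  refine (hcomp.congr_of_eventuallyEq ?_).differentiableWithinAt
  filter_upwards [hel] with w hw
  simp only [Function.comp_apply, hw]

end Painleve

section Reflection

theorem inv_conj_eq_self {ζ : ℂ} (hζ : ‖ζ‖ = 1) : (conj ζ)⁻¹ = ζ := by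
  rw [← Complex.inv_eq_conj hζ, inv_inv]

theorem norm_inv_conj (ζ : ℂ) : ‖(conj ζ)⁻¹‖ = ‖ζ‖⁻¹ := by
  rw [norm_inv, RCLike.norm_conj]

theorem norm_inv_conj_ne_one {ζ : ℂ} (hζ : ‖ζ‖ ≠ 1) : ‖(conj ζ)⁻¹‖ ≠ 1 := by
  rwa [norm_inv_conj, Ne, inv_eq_one]

theorem continuousAt_inv_conj {ζ : ℂ} (h0 : ζ ≠ 0) : ContinuousAt (fun w : ℂ => (conj w)⁻¹) ζ :=
  continuous_conj.continuousAt.inv₀ ((map_ne_zero _).mpr h0)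

variable {A : Type*} [NormedRing A] [StarRing A] {R G : ℂ → A} {O : Set ℂ}

/-- The function equal to `G` on the closed unit disc and to its reflection `1 - G(1/ζ̄)*` outside
it; the candidate for the analytic continuation of a function satisfying
`F(ζ)* + F(1/ζ̄) = 1`. -/
noncomputable def reflect (G : ℂ → A) (ζ : ℂ) : A :=
  if ‖ζ‖ ≤ 1 then G ζ else 1 - star (G (conj ζ)⁻¹)

theorem reflect_eq (hR : ∀ ζ, ζ ≠ 0 → ‖ζ‖ ≠ 1 → star (R ζ) + R (conj ζ)⁻¹ = 1)
    (hGR : EqOn G R (ball 0 1)) {ζ : ℂ} (hζ : ‖ζ‖ ≠ 1) : reflect G ζ = R ζ := by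
  rcases hζ.lt_or_gt with hlt | hgt
  · rw [reflect, if_pos hlt.le, hGR (mem_ball_zero_iff.mpr hlt)]
  · have hmem : (conj ζ)⁻¹ ∈ ball (0 : ℂ) 1 := by
      rw [mem_ball_zero_iff, norm_inv_conj]
      exact inv_lt_one_of_one_lt₀ hgt
    have hζ0 : ζ ≠ 0 := norm_pos_iff.mp (zero_lt_one.trans hgt)
    have h := hR (conj ζ)⁻¹ (inv_ne_zero ((map_ne_zero _).mpr hζ0)) (norm_inv_conj_ne_one hζ)
    rw [map_inv₀, conj_conj, inv_inv] at h
    rw [reflect, if_neg hgt.not_ge, hGR hmem, ← h, add_sub_cancel_left]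

theorem continuousOn_reflect [ContinuousStar A]
    (hG : ContinuousOn G (ball 0 1 ∪ sphere 0 1 ∩ O))
    (hGs : ∀ ζ ∈ sphere (0 : ℂ) 1 ∩ O, star (G ζ) + G ζ = 1) :
    ContinuousOn (reflect G) ({ζ | ‖ζ‖ ≠ 1} ∪ O) := by
  have hcirc : ∀ {ζ : ℂ}, ζ ∈ {ζ | ‖ζ‖ ≠ 1} ∪ O → ‖ζ‖ = 1 → ζ ∈ sphere (0 : ℂ) 1 ∩ O :=
    fun hζ h1 => ⟨mem_sphere_zero_iff_norm.mpr h1, hζ.resolve_left (not_not.mpr h1)⟩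
  have hset : {ζ : ℂ | ‖ζ‖ ≤ 1} = closedBall 0 1 := by
    ext; simp
  refine ContinuousOn.if ?_ ?_ ?_
  · rintro ζ ⟨hζ, hfr⟩
    rw [hset, frontier_closedBall _ one_ne_zero, mem_sphere_zero_iff_norm] at hfr
    rw [inv_conj_eq_self hfr, ← hGs ζ (hcirc hζ hfr), add_sub_cancel_left]
  · refine hG.mono ?_
    rintro ζ ⟨hζ, hcl⟩
    rw [hset, isClosed_closedBall.closure_eq, mem_closedBall_zero_iff] at hcl
    rcases hcl.lt_or_eq with hlt | heq
    · exact Or.inl (mem_ball_zero_iff.mpr hlt)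
    · exact Or.inr (hcirc hζ heq)
  · have hcl : closure {ζ : ℂ | ¬‖ζ‖ ≤ 1} = {ζ | 1 ≤ ‖ζ‖} := by
      rw [← compl_ofPred, hset, closure_compl, interior_closedBall _ one_ne_zero]
      ext; simp
    rw [hcl]
    refine continuousOn_const.sub (ContinuousOn.star (hG.comp ?_ ?_))
    · exact fun ζ hζ => (continuousAt_inv_conj
        (norm_pos_iff.mp (zero_lt_one.trans_le hζ.2))).continuousWithinAt
    · rintro ζ ⟨hζ, h1 : 1 ≤ ‖ζ‖⟩
      rcases h1.lt_or_eq with hlt | heq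
      · left
        rw [mem_ball_zero_iff, norm_inv_conj]
        exact inv_lt_one_of_one_lt₀ hlt
      · right
        simpa only [inv_conj_eq_self heq.symm] using hcirc hζ heq.symm

theorem exists_analyticOnNhd_of_star_add_eq_one [NormedAlgebra ℂ A] [ContinuousStar A]
    [CompleteSpace A] (hO : IsOpen O)
    (hd : ∀ ζ, ‖ζ‖ ≠ 1 → DifferentiableAt ℂ R ζ)
    (hR : ∀ ζ, ζ ≠ 0 → ‖ζ‖ ≠ 1 → star (R ζ) + R (conj ζ)⁻¹ = 1)
    (hG : ContinuousOn G (ball 0 1 ∪ sphere 0 1 ∩ O)) (hGR : EqOn G R (ball 0 1))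
    (hGs : ∀ ζ ∈ sphere (0 : ℂ) 1 ∩ O, star (G ζ) + G ζ = 1) :
    ∃ T : ℂ → A, AnalyticOnNhd ℂ T ({ζ | ‖ζ‖ < 1} ∪ {ζ | 1 < ‖ζ‖} ∪ sphere 0 1 ∩ O) ∧
      ∀ ζ, ‖ζ‖ ≠ 1 → T ζ = R ζ := by
  have hne : IsOpen {ζ : ℂ | ‖ζ‖ ≠ 1} := isOpen_ne.preimage continuous_norm
  refine ⟨reflect G, ?_, fun ζ hζ => reflect_eq hR hGR hζ⟩
  have hdiff : DifferentiableOn ℂ (reflect G) ({ζ | ‖ζ‖ ≠ 1} ∪ O) := by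
    refine differentiableOn_of_differentiableAt_off_circle (hne.union hO)
      (continuousOn_reflect hG hGs) fun ζ _ hζ => (hd ζ hζ).congr_of_eventuallyEq ?_
    filter_upwards [hne.mem_nhds hζ] with w hw using reflect_eq hR hGR hw
  refine (hdiff.analyticOnNhd (hne.union hO)).mono ?_
  rintro ζ ((hζ | hζ) | hζ)
  · exact Or.inl (show ‖ζ‖ < 1 from hζ).ne
  · exact Or.inl (show 1 < ‖ζ‖ from hζ).ne'
  · exact Or.inr hζ.2

end Reflection

section Mobius

theorem one_sub_conj_mul_self_ne_zero {z : ℂ} (hz : ‖z‖ < 1) : 1 - conj z * z ≠ 0 := by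
  intro h
  have h1 : ‖z‖ ^ 2 = 1 := by
    exact_mod_cast (conj_mul' z).symm.trans (sub_eq_zero.mp h).symm
  exact (pow_lt_one₀ (norm_nonneg z) hz two_ne_zero).ne h1

variable {A : Type*} [Ring A] [Algebra ℂ A]

theorem isUnit_smul_of_ne_zero {c : ℂ} (hc : c ≠ 0) {a : A} (ha : IsUnit a) : IsUnit (c • a) :=
  ha.smul (Units.mk0 c hc)

/-- The fractional linear transform `(W + z̄)(1 + z W)⁻¹`; it carries `V⁺_{z;C}` to `V_{C;z}`. -/
noncomputable def mobius (z : ℂ) (W : A) : A :=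
  (W + conj z • (1 : A)) * Ring.inverse (1 + z • W)

/-- The denominator of the fractional linear expression recovering `W` from the resolvent
`T = (1 - ζ (W + z̄)(1 + z W)⁻¹)⁻¹`. -/
noncomputable def resolventDen (z ζ : ℂ) (T : A) : A :=
  (ζ - z) • T + z • (1 : A)

/-- The numerator of the fractional linear expression recovering `W` from the resolvent
`T = (1 - ζ (W + z̄)(1 + z W)⁻¹)⁻¹`. -/
noncomputable def resolventNum (z ζ : ℂ) (T : A) : A :=
  (1 - ζ * conj z) • T - 1

/-- The solution `W` of `T = (1 - ζ (W + z̄)(1 + z W)⁻¹)⁻¹`. -/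
noncomputable def ofResolvent (z ζ : ℂ) (T : A) : A :=
  resolventNum z ζ T * Ring.inverse (resolventDen z ζ T)

variable {z ζ : ℂ} {W T : A}

theorem one_sub_smul_mobius_mul (ζ : ℂ) (ha : IsUnit (1 + z • W)) :
    (1 - ζ • mobius z W) * (1 + z • W) = (1 - ζ * conj z) • (1 : A) - (ζ - z) • W := by
  rw [sub_mul, smul_mul_assoc, mobius, mul_assoc, Ring.inverse_mul_cancel _ ha]
  simp only [mul_one, one_mul]
  module

theorem resolventDen_mul (ha : IsUnit (1 + z • W)) (hT : T * (1 - ζ • mobius z W) = 1) :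
    resolventDen z ζ T * ((1 - ζ * conj z) • (1 : A) - (ζ - z) • W) =
      (ζ * (1 - conj z * z)) • (1 : A) := by
  rw [resolventDen, add_mul, smul_mul_assoc, ← one_sub_smul_mobius_mul ζ ha, ← mul_assoc, hT,
    one_mul, one_sub_smul_mobius_mul ζ ha, smul_mul_assoc, one_mul]
  module

theorem resolventNum_mul (ha : IsUnit (1 + z • W)) (hT : T * (1 - ζ • mobius z W) = 1) :
    resolventNum z ζ T * ((1 - ζ * conj z) • (1 : A) - (ζ - z) • W) =
      (ζ * (1 - conj z * z)) • W := by
  rw [resolventNum, sub_mul, smul_mul_assoc, ← one_sub_smul_mobius_mul ζ ha, ← mul_assoc, hT,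
    one_mul, one_sub_smul_mobius_mul ζ ha, one_mul]
  module

theorem ofResolvent_inverse (hz : ‖z‖ < 1) (hζ : ζ ≠ 0) (ha : IsUnit (1 + z • W))
    (hu : IsUnit (1 - ζ • mobius z W)) :
    ofResolvent z ζ (Ring.inverse (1 - ζ • mobius z W)) = W := by
  have hT := Ring.inverse_mul_cancel _ hu
  set T := Ring.inverse (1 - ζ • mobius z W)
  have hκ : ζ * (1 - conj z * z) ≠ 0 := mul_ne_zero hζ (one_sub_conj_mul_self_ne_zero hz)
  have hDB := resolventDen_mul ha hT
  have hNB := resolventNum_mul ha hT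
  have hB := hu.mul ha
  rw [one_sub_smul_mobius_mul ζ ha] at hB
  set B := (1 - ζ * conj z) • (1 : A) - (ζ - z) • W
  have hD : IsUnit (resolventDen z ζ T) := by
    have h : IsUnit (resolventDen z ζ T * B) := hDB ▸ isUnit_smul_of_ne_zero hκ isUnit_one
    exact hB.unit.isUnit_mul_units _ |>.mp h
  rw [ofResolvent, eq_comm, Ring.eq_mul_inverse_iff_mul_eq _ _ _ hD]
  refine hB.mul_right_cancel ?_
  rw [mul_assoc, hDB, hNB, mul_smul_comm, mul_one]

theorem isUnit_one_sub_smul_mobius_ofResolvent (hz : ‖z‖ < 1) (hζ : ζ ≠ 0)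
    (hD : IsUnit (resolventDen z ζ T)) (ha : IsUnit (1 + z • ofResolvent z ζ T)) :
    IsUnit (1 - ζ • mobius z (ofResolvent z ζ T)) := by
  have hW : ofResolvent z ζ T * resolventDen z ζ T = resolventNum z ζ T :=
    Ring.inverse_mul_cancel_right _ _ hD
  have hprod : (1 - ζ • mobius z (ofResolvent z ζ T)) * (1 + z • ofResolvent z ζ T) *
      resolventDen z ζ T = (ζ * (1 - conj z * z)) • (1 : A) := by
    rw [one_sub_smul_mobius_mul ζ ha, sub_mul, smul_mul_assoc, one_mul, smul_mul_assoc, hW,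
      resolventDen, resolventNum]
    module
  have hκ : ζ * (1 - conj z * z) ≠ 0 := mul_ne_zero hζ (one_sub_conj_mul_self_ne_zero hz)
  have hu := hprod ▸ isUnit_smul_of_ne_zero hκ (isUnit_one (M := A))
  exact ha.unit.isUnit_mul_units _ |>.mp (hD.unit.isUnit_mul_units _ |>.mp hu)

theorem isUnit_one_add_smul_of_norm_le_one {B : Type*} [NormedRing B] [NormedAlgebra ℂ B]
    [CompleteSpace B] {W : B} (hz : ‖z‖ < 1) (hW : ‖W‖ ≤ 1) : IsUnit (1 + z • W) := by
  have h : ‖-(z • W)‖ < 1 := by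
    rw [norm_neg, norm_smul]
    exact (mul_le_of_le_one_right (norm_nonneg z) hW).trans_lt hz
  simpa only [sub_neg_eq_add] using isUnit_one_sub_of_norm_lt_one h

theorem tendsto_ringInverse {B α : Type*} [NormedRing B] [CompleteSpace B] {l : Filter α}
    {f : α → B} {b : B} (hf : Tendsto f l (𝓝 b)) (hb : IsUnit b) :
    Tendsto (fun x => Ring.inverse (f x)) l (𝓝 (Ring.inverse b)) :=
  (NormedRing.inverse_continuousAt hb.unit).tendsto.comp hf

theorem tendsto_ofResolvent {B α : Type*} [NormedRing B] [NormedAlgebra ℂ B] [CompleteSpace B]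
    {l : Filter α} {w : α → ℂ} {S : α → B} {T : B} (hw : Tendsto w l (𝓝 ζ))
    (hS : Tendsto S l (𝓝 T)) (hD : IsUnit (resolventDen z ζ T)) :
    Tendsto (fun x => ofResolvent z (w x) (S x)) l (𝓝 (ofResolvent z ζ T)) := by
  have hden : Tendsto (fun x => resolventDen z (w x) (S x)) l (𝓝 (resolventDen z ζ T)) :=
    ((hw.sub_const z).smul hS).add_const _
  have hnum : Tendsto (fun x => resolventNum z (w x) (S x)) l (𝓝 (resolventNum z ζ T)) :=
    (((hw.mul_const (conj z)).const_sub 1).smul hS).sub_const 1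
  exact hnum.mul (tendsto_ringInverse hden hD)

end Mobius

section Star

theorem star_mul_ringInverse_mem_unitary {A : Type*} [Semiring A] [StarRing A] {a : A}
    [IsStarNormal a] (ha : IsUnit a) : star a * Ring.inverse a ∈ unitary A := by
  refine (ha.star.mul ha.ringInverse).mem_unitary_of_star_mul_self ?_
  calc star (star a * Ring.inverse a) * (star a * Ring.inverse a)
      = Ring.inverse (star a) * (a * star a) * Ring.inverse a := by
        rw [star_mul, star_star, ← Ring.inverse_star]; simp only [mul_assoc]
    _ = (Ring.inverse (star a) * star a) * (a * Ring.inverse a) := by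
        rw [← star_comm_self']; simp only [mul_assoc]
    _ = 1 := by rw [Ring.inverse_mul_cancel _ ha.star, Ring.mul_inverse_cancel _ ha, mul_one]

variable {A : Type*} [Ring A] [StarRing A] [Algebra ℂ A] [StarModule ℂ A] {z ζ : ℂ} {T B : A}

theorem star_inverse_add_inverse_one_sub_smul (hB : star B * B = 1) (h0 : ζ ≠ 0)
    (hu : IsUnit (1 - ζ • B)) (hu' : IsUnit (1 - (conj ζ)⁻¹ • B)) :
    star (Ring.inverse (1 - ζ • B)) + Ring.inverse (1 - (conj ζ)⁻¹ • B) = 1 := by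
  have hc : conj ζ ≠ 0 := (map_ne_zero _).mpr h0
  have hsum : star (1 - ζ • B) + (1 - (conj ζ)⁻¹ • B) =
      star (1 - ζ • B) * (1 - (conj ζ)⁻¹ • B) := by
    simp only [star_sub, star_one, star_smul, ← starRingEnd_apply ζ, mul_sub, sub_mul, mul_one,
      one_mul, smul_mul_smul_comm, hB, mul_inv_cancel₀ hc, one_smul]
    abel
  rw [← Ring.inverse_star, Ring.inverse_add_inverse (iff_of_true hu.star hu'), hsum,
    Ring.inverse_mul_cancel_left _ _ hu.star, Ring.mul_inverse_cancel _ hu']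

theorem star_mobius_mul_self (hB : star B * B = 1) (ha : IsUnit (1 + z • B)) :
    star (mobius z B) * mobius z B = 1 := by
  have hnum : star (B + conj z • (1 : A)) * (B + conj z • (1 : A)) =
      star (1 + z • B) * (1 + z • B) := by
    simp only [star_add, star_one, star_smul, starRingEnd_apply, star_star, mul_add, add_mul,
      mul_one, one_mul, smul_mul_assoc, mul_smul_comm, hB]
    module
  rw [mobius, star_mul, ← Ring.inverse_star, mul_assoc, ← mul_assoc (star _), hnum, mul_assoc,
    Ring.mul_inverse_cancel _ ha, mul_one, Ring.inverse_mul_cancel _ ha.star]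

theorem resolventNum_eq_neg_smul_star (hζ : ‖ζ‖ = 1) (hT : star T + T = 1) :
    resolventNum z ζ T = -ζ • star (resolventDen z ζ T) := by
  have hζ' : ζ * star ζ = 1 := by simp [← starRingEnd_apply, mul_conj', hζ]
  simp only [resolventNum, resolventDen, star_add, star_smul, star_sub, star_one,
    eq_sub_of_add_eq hT, starRingEnd_apply]
  match_scalars
  · linear_combination -hζ'
  · linear_combination hζ'

theorem isStarNormal_resolventDen (hT : star T + T = 1) : IsStarNormal (resolventDen z ζ T) := by
  refine ⟨?_⟩
  have hcomm : Commute (star T) T := by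
    rw [eq_sub_of_add_eq hT]
    exact (Commute.one_left T).sub_left (Commute.refl T)
  simp only [resolventDen, star_add, star_smul, star_one]
  exact ((hcomm.smul_left _).smul_right _).add_right ((Commute.one_right _).smul_right _)
    |>.add_left ((Commute.one_left _).smul_left _)

theorem ofResolvent_mem_unitary (hζ : ‖ζ‖ = 1) (hT : star T + T = 1)
    (hD : IsUnit (resolventDen z ζ T)) : ofResolvent z ζ T ∈ unitary A := by
  have := isStarNormal_resolventDen (z := z) (ζ := ζ) hT
  rw [ofResolvent, resolventNum_eq_neg_smul_star hζ hT, smul_mul_assoc]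
  refine Unitary.smul_mem_of_mem ?_ (star_mul_ringInverse_mem_unitary hD)
  simp [Unitary.mem_iff_self_mul_star, ← starRingEnd_apply, mul_conj', hζ]

end Star

section CStar

variable {A : Type*} [CStarAlgebra A]

theorem isUnit_one_sub_smul_of_mem_unitary {U : A} (hU : U ∈ unitary A) {ζ : ℂ} (hζ : ‖ζ‖ ≠ 1) :
    IsUnit (1 - ζ • U) := by
  rcases eq_or_ne ζ 0 with rfl | h0
  · simp
  have h : ζ⁻¹ ∉ spectrum ℂ U := fun h => hζ <| by
    simpa using spectrum.subset_circle_of_unitary hU h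
  rw [spectrum.notMem_iff, Algebra.algebraMap_eq_smul_one] at h
  simpa [smul_sub, smul_smul, mul_inv_cancel₀ h0] using isUnit_smul_of_ne_zero h0 h

theorem conj_add_self_of_mem_spectrum {T : A} (hT : star T + T = 1) {w : ℂ}
    (hw : w ∈ spectrum ℂ T) : conj w + w = 1 := by
  let S : A := I • (T - algebraMap ℂ A 2⁻¹)
  have hS : IsSelfAdjoint S := by
    simp only [S, IsSelfAdjoint, star_smul, star_sub, eq_sub_of_add_eq hT, ← starRingEnd_apply,
      conj_I, Algebra.algebraMap_eq_smul_one, star_one, map_inv₀, map_ofNat]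
    module
  have hwS : I * (w - 2⁻¹) ∈ spectrum ℂ S := by
    have h : w - 2⁻¹ ∈ spectrum ℂ (T - algebraMap ℂ A 2⁻¹) :=
      spectrum.sub_singleton_eq T (2⁻¹ : ℂ) ▸ sub_mem_sub hw rfl
    exact (spectrum.smul_mem_smul_iff (r := Units.mk0 I I_ne_zero)).mpr h
  have him := congrArg im (hS.mem_spectrum_eq_re hwS)
  have hre : 2 * w.re = 1 := by
    simp at him
    linarith
  rw [add_comm, add_conj]
  exact_mod_cast hre

theorem isUnit_resolventDen {z ζ : ℂ} {T : A} (hzζ : ‖z‖ ≠ ‖ζ‖) (hT : star T + T = 1) :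
    IsUnit (resolventDen z ζ T) := by
  have hne : ζ - z ≠ 0 := sub_ne_zero.mpr fun h => hzζ (h ▸ rfl)
  have hw : -z / (ζ - z) ∉ spectrum ℂ T := fun h => hzζ <| by
    have h1 : conj (-z / (ζ - z)) = ζ / (ζ - z) := by
      rw [eq_sub_of_add_eq (conj_add_self_of_mem_spectrum hT h)]
      field_simp
      ring
    have h2 := congrArg norm h1
    rw [RCLike.norm_conj, norm_div, norm_div, norm_neg] at h2
    exact (div_left_inj' (norm_ne_zero_iff.mpr hne)).mp h2
  rw [spectrum.notMem_iff, Algebra.algebraMap_eq_smul_one] at hw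
  convert isUnit_smul_of_ne_zero (neg_ne_zero.mpr hne) hw using 1
  rw [resolventDen, smul_sub, smul_smul, neg_mul, mul_div_cancel₀ _ hne]
  module

end CStar

section Extension

variable {H : Type u} [NormedAddCommGroup H] [InnerProductSpace ℂ H] {V : H →ₗ.[ℂ] H} {z : ℂ}

theorem norm_M_add_N_sq {m n : H} (hm : m ∈ M V z) (hn : n ∈ N V z) :
    ‖m + n‖ ^ 2 = ‖m‖ ^ 2 + ‖n‖ ^ 2 := by
  simpa only [sq] using norm_add_sq_eq_norm_sq_add_norm_sq_of_inner_eq_zero m n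
    (Submodule.inner_right_of_mem_orthogonal hm hn)

theorem Vz_mem_M (hV : IsClosedIsometric V) (hz : ‖z‖ < 1) (h0 : z ≠ 0) (m : M V z) :
    Vz hV hz m ∈ M V (conj z)⁻¹ := by
  obtain ⟨x, rfl⟩ := (idSubInv hV hz).symm.surjective m
  have hVx : Vz hV hz ((idSubInv hV hz).symm x) = V x - conj z • (x : H) := by
    simp [Vz]
  refine ⟨-conj z • x, ?_⟩
  rw [hVx, map_smul, idSub_apply, smul_sub, smul_smul, neg_mul,
    mul_inv_cancel₀ ((map_ne_zero _).mpr h0)]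
  module

variable [CompleteSpace H]

theorem exists_eq_M_add_N (hV : IsClosedIsometric V) (hz : ‖z‖ < 1) (x : H) :
    ∃ (m : M V z) (n : N V z), x = m + n := by
  have := hasOrthogonalProjection_M hV hz
  obtain ⟨m, hm, n, hn, h⟩ := (M V z).exists_add_mem_mem_orthogonal x
  exact ⟨⟨m, hm⟩, ⟨n, hn⟩, h⟩

theorem Vplus_apply_M (hV : IsClosedIsometric V) (hz : ‖z‖ < 1)
    (C : N V z →L[ℂ] N V (conj z)⁻¹) (m : M V z) : Vplus hV hz C m = Vz hV hz m := by
  have := hasOrthogonalProjection_M hV hz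
  have h : (N V z).orthogonalProjectionOnto (m : H) = 0 :=
    Submodule.orthogonalProjectionOnto_orthogonal_apply_eq_zero m.2
  simp [Vplus, h]

theorem Vplus_apply_N (hV : IsClosedIsometric V) (hz : ‖z‖ < 1)
    (C : N V z →L[ℂ] N V (conj z)⁻¹) (n : N V z) : Vplus hV hz C n = C n := by
  have := hasOrthogonalProjection_M hV hz
  have h : (M V z).orthogonalProjectionOnto (n : H) = 0 :=
    Submodule.orthogonalProjectionOnto_eq_zero_iff.mpr n.2
  simp [Vplus, h]

theorem norm_Vplus_M_add_N_sq (hV : IsClosedIsometric V) (hz : ‖z‖ < 1) (h0 : z ≠ 0)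
    (C : N V z →L[ℂ] N V (conj z)⁻¹) (m : M V z) (n : N V z) :
    ‖Vplus hV hz C (m + n)‖ ^ 2 = ‖m‖ ^ 2 + ‖C n‖ ^ 2 := by
  rw [map_add, Vplus_apply_M, Vplus_apply_N, norm_M_add_N_sq (Vz_mem_M hV hz h0 m) (C n).2,
    (Vz hV hz).norm_map, Submodule.coe_norm (C n)]

theorem norm_Vplus_le_one (hV : IsClosedIsometric V) (hz : ‖z‖ < 1) (h0 : z ≠ 0)
    {C : N V z →L[ℂ] N V (conj z)⁻¹} (hC : ‖C‖ ≤ 1) : ‖Vplus hV hz C‖ ≤ 1 := by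
  refine ContinuousLinearMap.opNorm_le_bound _ zero_le_one fun x => ?_
  obtain ⟨m, n, rfl⟩ := exists_eq_M_add_N hV hz x
  rw [one_mul, ← sq_le_sq₀ (norm_nonneg _) (norm_nonneg _), norm_Vplus_M_add_N_sq hV hz h0,
    norm_M_add_N_sq m.2 n.2, Submodule.coe_norm]
  have hn : ‖C n‖ ≤ ‖n‖ := by simpa only [one_mul] using C.le_of_opNorm_le hC n
  gcongr
  exact hn

theorem norm_Vplus_apply_iff (hV : IsClosedIsometric V) (hz : ‖z‖ < 1) (h0 : z ≠ 0)
    {C : N V z →L[ℂ] N V (conj z)⁻¹} :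
    (∀ x, ‖Vplus hV hz C x‖ = ‖x‖) ↔ ∀ n, ‖C n‖ = ‖n‖ := by
  refine ⟨fun h n => ?_, fun h x => ?_⟩
  · simpa only [Vplus_apply_N, Submodule.coe_norm] using h n
  · obtain ⟨m, n, rfl⟩ := exists_eq_M_add_N hV hz x
    rw [← sq_eq_sq₀ (norm_nonneg _) (norm_nonneg _), norm_Vplus_M_add_N_sq hV hz h0,
      norm_M_add_N_sq m.2 n.2, h, Submodule.coe_norm, Submodule.coe_norm n]

theorem surjective_of_surjective_Vplus (hV : IsClosedIsometric V) (hz : ‖z‖ < 1) (h0 : z ≠ 0)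
    {C : N V z →L[ℂ] N V (conj z)⁻¹} (h : Function.Surjective (Vplus hV hz C)) :
    Function.Surjective C := by
  intro y
  obtain ⟨x, hx⟩ := h y
  obtain ⟨m, n, rfl⟩ := exists_eq_M_add_N hV hz x
  rw [map_add, Vplus_apply_M, Vplus_apply_N] at hx
  have hdiff : (y - C n : H) ∈ M V (conj z)⁻¹ := by
    rw [← hx, add_sub_cancel_right]
    exact Vz_mem_M hV hz h0 m
  have hzero : (y - C n : H) = 0 :=
    (Submodule.disjoint_def.mp (Submodule.orthogonal_disjoint _)) _ hdiff
      (Submodule.sub_mem _ y.2 (C n).2)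
  exact ⟨n, Subtype.ext (sub_eq_zero.mp hzero).symm⟩

/-- The compression of an operator in `H` to an operator from `N_z` to `N_{1/z̄}`; it recovers `C`
from `V⁺_{z;C}`. -/
noncomputable def compression (V : H →ₗ.[ℂ] H) (z : ℂ) (W : H →L[ℂ] H) :
    N V z →L[ℂ] N V (conj z)⁻¹ :=
  (N V (conj z)⁻¹).orthogonalProjectionOnto ∘L W ∘L (N V z).subtypeL

theorem compression_Vplus (hV : IsClosedIsometric V) (hz : ‖z‖ < 1)
    (C : N V z →L[ℂ] N V (conj z)⁻¹) : compression V z (Vplus hV hz C) = C := by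
  ext n
  simp [compression, Vplus_apply_N]

theorem continuous_Vplus (hV : IsClosedIsometric V) (hz : ‖z‖ < 1) : Continuous (Vplus hV hz) := by
  unfold Vplus
  fun_prop

theorem isClosedEmbedding_Vplus (hV : IsClosedIsometric V) (hz : ‖z‖ < 1) :
    IsClosedEmbedding (Vplus hV hz) := by
  have hcont : Continuous (compression V z) := by
    unfold compression
    fun_prop
  exact Function.LeftInverse.isClosedEmbedding (compression_Vplus hV hz) hcont
    (continuous_Vplus hV hz)

theorem isUnit_one_add_smul_Vplus (hV : IsClosedIsometric V) (hz : ‖z‖ < 1) (h0 : z ≠ 0)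
    {C : N V z →L[ℂ] N V (conj z)⁻¹} (hC : ‖C‖ ≤ 1) : IsUnit (1 + z • Vplus hV hz C) :=
  isUnit_one_add_smul_of_norm_le_one hz (norm_Vplus_le_one hV hz h0 hC)

theorem continuousOn_inverse_one_sub_smul_VC (hV : IsClosedIsometric V) (hz : ‖z‖ < 1)
    (h0 : z ≠ 0) {C : ℂ → (N V z →L[ℂ] N V (conj z)⁻¹)} {S : Set ℂ} (hc : ContinuousOn C S)
    (hn : ∀ ζ ∈ S, ‖C ζ‖ ≤ 1) (hu : ∀ ζ ∈ S, IsUnit (1 - ζ • VC hV hz (C ζ))) :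
    ContinuousOn (fun ζ => Ring.inverse (1 - ζ • VC hV hz (C ζ))) S := by
  intro ζ hζ
  have hW : Tendsto (fun w => Vplus hV hz (C w)) (𝓝[S] ζ) (𝓝 (Vplus hV hz (C ζ))) :=
    ((continuous_Vplus hV hz).tendsto _).comp (hc ζ hζ)
  have hVC : Tendsto (fun w => VC hV hz (C w)) (𝓝[S] ζ) (𝓝 (VC hV hz (C ζ))) :=
    (hW.add_const _).mul (tendsto_ringInverse ((hW.const_smul z).const_add 1)
      (isUnit_one_add_smul_Vplus hV hz h0 (hn ζ hζ)))
  exact tendsto_ringInverse ((continuousWithinAt_id.tendsto.smul hVC).const_sub 1) (hu ζ hζ)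

end Extension

section Resolvent

variable {H : Type u} [NormedAddCommGroup H] [InnerProductSpace ℂ H] [CompleteSpace H]
  {V : H →ₗ.[ℂ] H} {R : ℂ → (H →L[ℂ] H)}

theorem IsGeneralizedResolvent.differentiableAt (hR : IsGeneralizedResolvent.{u, v} V R) {ζ : ℂ}
    (hζ : ‖ζ‖ ≠ 1) : DifferentiableAt ℂ R ζ := by
  obtain ⟨K, _, _, _, ι, U, hU, -, hRU⟩ := hR
  have hinv : DifferentiableAt ℂ (fun w : ℂ => Ring.inverse (1 - w • U)) ζ :=
    DifferentiableAt.comp (f := fun w : ℂ => 1 - w • U) ζ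
      (differentiableAt_inverse (isUnit_one_sub_smul_of_mem_unitary hU hζ)) (by fun_prop)
  refine ((differentiableAt_const (ContinuousLinearMap.adjoint ι.toContinuousLinearMap)).clm_comp
    (hinv.clm_comp (differentiableAt_const ι.toContinuousLinearMap))).congr_of_eventuallyEq ?_
  filter_upwards [(isOpen_ne.preimage continuous_norm).mem_nhds hζ] with w hw using hRU w hw

theorem IsGeneralizedResolvent.star_add (hR : IsGeneralizedResolvent.{u, v} V R) {ζ : ℂ}
    (h0 : ζ ≠ 0) (hζ : ‖ζ‖ ≠ 1) : star (R ζ) + R (conj ζ)⁻¹ = 1 := by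
  obtain ⟨K, _, _, _, ι, U, hU, -, hRU⟩ := hR
  have hζ' := norm_inv_conj_ne_one hζ
  have h := star_inverse_add_inverse_one_sub_smul (Unitary.star_mul_self_of_mem hU) h0
    (isUnit_one_sub_smul_of_mem_unitary hU hζ) (isUnit_one_sub_smul_of_mem_unitary hU hζ')
  rw [hRU ζ hζ, hRU _ hζ', ContinuousLinearMap.star_eq_adjoint, ContinuousLinearMap.adjoint_comp,
    ContinuousLinearMap.adjoint_comp, ContinuousLinearMap.adjoint_adjoint,
    ContinuousLinearMap.comp_assoc, ← ContinuousLinearMap.comp_add,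
    ← ContinuousLinearMap.add_comp, ← ContinuousLinearMap.star_eq_adjoint, h]
  exact (ContinuousLinearMap.norm_map_iff_adjoint_comp_self _).mp ι.norm_map

theorem tendsto_inv_conj_off_circle {ζ : ℂ} (hζ : ‖ζ‖ = 1) :
    Tendsto (fun w : ℂ => (conj w)⁻¹) (𝓝[{w | ‖w‖ ≠ 1}] ζ) (𝓝[{w | ‖w‖ ≠ 1}] ζ) := by
  have hcont := continuousAt_inv_conj (norm_ne_zero_iff.mp (hζ ▸ one_ne_zero : ‖ζ‖ ≠ 0))
  refine tendsto_nhdsWithin_iff.mpr ⟨?_, ?_⟩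
  · simpa only [inv_conj_eq_self hζ] using hcont.tendsto.mono_left nhdsWithin_le_nhds
  · filter_upwards [self_mem_nhdsWithin] with w hw using norm_inv_conj_ne_one hw

theorem nhdsWithin_ball_neBot {ζ : ℂ} (hζ : ‖ζ‖ = 1) : (𝓝[ball (0 : ℂ) 1] ζ).NeBot := by
  rw [← mem_closure_iff_nhdsWithin_neBot, closure_ball _ one_ne_zero]
  simp [hζ]

theorem ball_subset_off_circle : ball (0 : ℂ) 1 ⊆ {w | ‖w‖ ≠ 1} :=
  fun _ hw => (mem_ball_zero_iff.mp hw).ne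

theorem IsGeneralizedResolvent.star_add_self_of_tendsto (hR : IsGeneralizedResolvent.{u, v} V R)
    {ζ : ℂ} (hζ : ‖ζ‖ = 1) {L : H →L[ℂ] H} (hL : Tendsto R (𝓝[{w | ‖w‖ ≠ 1}] ζ) (𝓝 L)) :
    star L + L = 1 := by
  have := (nhdsWithin_ball_neBot hζ).mono (nhdsWithin_mono ζ ball_subset_off_circle)
  have hζ0 : ζ ≠ 0 := norm_ne_zero_iff.mp (hζ ▸ one_ne_zero)
  refine tendsto_nhds_unique (hL.star.add (hL.comp (tendsto_inv_conj_off_circle hζ)))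
    (tendsto_const_nhds.congr' ?_)
  filter_upwards [self_mem_nhdsWithin, nhdsWithin_le_nhds (isOpen_ne.mem_nhds hζ0)] with w hw hw0
    using (hR.star_add hw0 hw).symm

end Resolvent

section Inin

variable {H : Type u} [NormedAddCommGroup H] [InnerProductSpace ℂ H] [CompleteSpace H]
  {V : H →ₗ.[ℂ] H} {R : ℂ → (H →L[ℂ] H)} {z : ℂ} {C : ℂ → (N V z →L[ℂ] N V (conj z)⁻¹)}
  {hV : IsClosedIsometric V} {hz : ‖z‖ < 1}

theorem IninCorresponds.isUnit (hC : IninCorresponds hV hz R C) {ζ : ℂ}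
    (hζ : ζ ∈ ball (0 : ℂ) 1) : IsUnit (1 - ζ • VC hV hz (C ζ)) :=
  ⟨⟨_, R ζ, hC.right_inv ζ hζ, hC.left_inv ζ hζ⟩, rfl⟩

theorem IninCorresponds.inverse_eq (hC : IninCorresponds hV hz R C) {ζ : ℂ}
    (hζ : ζ ∈ ball (0 : ℂ) 1) : Ring.inverse (1 - ζ • VC hV hz (C ζ)) = R ζ :=
  Ring.inverse_unit ⟨_, R ζ, hC.right_inv ζ hζ, hC.left_inv ζ hζ⟩

theorem IninCorresponds.ofResolvent_eq_Vplus (hC : IninCorresponds hV hz R C) (h0 : z ≠ 0) {ζ : ℂ}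
    (hζ : ζ ∈ ball (0 : ℂ) 1) (hζ0 : ζ ≠ 0) : ofResolvent z ζ (R ζ) = Vplus hV hz (C ζ) := by
  rw [← hC.inverse_eq hζ]
  exact ofResolvent_inverse hz hζ0
    (isUnit_one_add_smul_Vplus hV hz h0 (hC.schur.contraction ζ hζ)) (hC.isUnit hζ)

theorem IninCorresponds.exists_tendsto (hC : IninCorresponds hV hz R C) (h0 : z ≠ 0)
    (hR : IsGeneralizedResolvent.{u, v} V R) {ζ : ℂ} (hζ : ‖ζ‖ = 1) {L : H →L[ℂ] H}
    (hL : Tendsto R (𝓝[{w | ‖w‖ ≠ 1}] ζ) (𝓝 L)) :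
    ∃ C₀ : N V z →L[ℂ] N V (conj z)⁻¹, Tendsto C (𝓝[ball 0 1] ζ) (𝓝 C₀) ∧
      ((∀ x, ‖C₀ x‖ = ‖x‖) ∧ Function.Surjective C₀) ∧
      Function.Bijective (1 - ζ • VC hV hz C₀ : H →L[ℂ] H) := by
  have := nhdsWithin_ball_neBot hζ
  have hζ0 : ζ ≠ 0 := norm_ne_zero_iff.mp (hζ ▸ one_ne_zero)
  have hLs : star L + L = 1 := hR.star_add_self_of_tendsto hζ hL
  have hD : IsUnit (resolventDen z ζ L) := isUnit_resolventDen (hζ ▸ hz.ne) hLs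
  have hW : ofResolvent z ζ L ∈ unitary (H →L[ℂ] H) := ofResolvent_mem_unitary hζ hLs hD
  have hVplus : Tendsto (fun w => Vplus hV hz (C w)) (𝓝[ball 0 1] ζ) (𝓝 (ofResolvent z ζ L)) := by
    refine (tendsto_ofResolvent (tendsto_id.mono_left nhdsWithin_le_nhds)
      (hL.mono_left (nhdsWithin_mono ζ ball_subset_off_circle)) hD).congr' ?_
    filter_upwards [self_mem_nhdsWithin, nhdsWithin_le_nhds (isOpen_ne.mem_nhds hζ0)]
      with w hw hw0 using hC.ofResolvent_eq_Vplus h0 hw hw0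
  have hemb := isClosedEmbedding_Vplus hV hz
  obtain ⟨C₀, hC₀⟩ : ofResolvent z ζ L ∈ range (Vplus hV hz) :=
    hemb.isClosed_range.mem_of_tendsto hVplus (Eventually.of_forall fun w => mem_range_self (C w))
  have hnorm : ∀ x, ‖Vplus hV hz C₀ x‖ = ‖x‖ := fun x => by
    rw [hC₀, ContinuousLinearMap.norm_map_of_mem_unitary hW]
  have hsurj : Function.Surjective (Vplus hV hz C₀) := fun y =>
    ⟨star (ofResolvent z ζ L) y, by
      rw [hC₀]; exact DFunLike.congr_fun (Unitary.mul_star_self_of_mem hW) y⟩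
  have ha : IsUnit (1 + z • ofResolvent z ζ L) := isUnit_one_add_smul_of_norm_le_one hz <|
    ContinuousLinearMap.opNorm_le_bound _ zero_le_one fun x => by
      rw [one_mul, ContinuousLinearMap.norm_map_of_mem_unitary hW]
  refine ⟨C₀, hemb.tendsto_nhds_iff.mpr (hC₀ ▸ hVplus),
    ⟨(norm_Vplus_apply_iff hV hz h0).mp hnorm, surjective_of_surjective_Vplus hV hz h0 hsurj⟩, ?_⟩
  have hu := isUnit_one_sub_smul_mobius_ofResolvent hz hζ0 hD ha
  rw [← hC₀] at hu
  exact ContinuousLinearMap.isUnit_iff_bijective.mp hu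

theorem IninCorresponds.exists_extension (hC : IninCorresponds hV hz R C) (h0 : z ≠ 0)
    (hR : IsGeneralizedResolvent.{u, v} V R) {Δ : Set ℂ} (hΔ : Δ ⊆ sphere 0 1)
    (h : HasAnalyticContinuation R Δ) :
    ∃ C' : ℂ → (N V z →L[ℂ] N V (conj z)⁻¹),
      (∀ ζ ∈ ball (0 : ℂ) 1, C' ζ = C ζ) ∧ ContinuousOn C' (ball (0 : ℂ) 1 ∪ Δ) ∧
      (∀ ζ ∈ Δ, (∀ x, ‖C' ζ x‖ = ‖x‖) ∧ Function.Surjective (C' ζ)) ∧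
      ∀ ζ ∈ Δ, Function.Bijective (1 - ζ • VC hV hz (C' ζ) : H →L[ℂ] H) := by
  obtain ⟨T, hT, hTR⟩ := h
  have hL : ∀ ζ ∈ Δ, Tendsto R (𝓝[{w | ‖w‖ ≠ 1}] ζ) (𝓝 (T ζ)) := fun ζ hζ => by
    refine ((hT ζ (Or.inr hζ)).continuousAt.tendsto.mono_left nhdsWithin_le_nhds).congr' ?_
    filter_upwards [self_mem_nhdsWithin] with w hw using hTR w hw
  choose! C₀ hlim hiso hbij using fun ζ hζ =>
    hC.exists_tendsto h0 hR (mem_sphere_zero_iff_norm.mp (hΔ hζ)) (hL ζ hζ)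
  have hcont : ContinuousOn C (ball 0 1) := hC.schur.analytic.continuousOn
  have hsub : ball 0 1 ∪ Δ ⊆ closure (ball (0 : ℂ) 1) := by
    rw [closure_ball _ one_ne_zero]
    exact union_subset ball_subset_closedBall (hΔ.trans sphere_subset_closedBall)
  let C' : ℂ → (N V z →L[ℂ] N V (conj z)⁻¹) := extendFrom (ball 0 1) C
  have hC' : ∀ ζ ∈ Δ, C' ζ = C₀ ζ := fun ζ hζ => extendFrom_eq (hsub (Or.inr hζ)) (hlim ζ hζ)
  refine ⟨C', fun ζ hζ => extendFrom_eq (subset_closure hζ) (hcont ζ hζ),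
    continuousOn_extendFrom hsub ?_, fun ζ hζ => hC' ζ hζ ▸ hiso ζ hζ,
    fun ζ hζ => hC' ζ hζ ▸ hbij ζ hζ⟩
  rintro ζ (hζ | hζ)
  exacts [⟨C ζ, hcont ζ hζ⟩, ⟨C₀ ζ, hlim ζ hζ⟩]

theorem IninCorresponds.hasAnalyticContinuation (hC : IninCorresponds hV hz R C) (h0 : z ≠ 0)
    (hR : IsGeneralizedResolvent.{u, v} V R) {O : Set ℂ} (hO : IsOpen O)
    {C' : ℂ → (N V z →L[ℂ] N V (conj z)⁻¹)} (hCC' : ∀ ζ ∈ ball (0 : ℂ) 1, C' ζ = C ζ)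
    (hc : ContinuousOn C' (ball (0 : ℂ) 1 ∪ sphere 0 1 ∩ O))
    (hiso : ∀ ζ ∈ sphere (0 : ℂ) 1 ∩ O, ∀ x, ‖C' ζ x‖ = ‖x‖)
    (hbij : ∀ ζ ∈ sphere (0 : ℂ) 1 ∩ O,
      Function.Bijective (1 - ζ • VC hV hz (C' ζ) : H →L[ℂ] H)) :
    HasAnalyticContinuation R (sphere 0 1 ∩ O) := by
  have hnorm : ∀ ζ ∈ ball (0 : ℂ) 1 ∪ sphere 0 1 ∩ O, ‖C' ζ‖ ≤ 1 := by
    rintro ζ (hζ | hζ)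
    · exact hCC' ζ hζ ▸ hC.schur.contraction ζ hζ
    · exact ContinuousLinearMap.opNorm_le_bound _ zero_le_one fun x => by
        rw [hiso ζ hζ, one_mul]
  have hunit : ∀ ζ ∈ ball (0 : ℂ) 1 ∪ sphere 0 1 ∩ O, IsUnit (1 - ζ • VC hV hz (C' ζ)) := by
    rintro ζ (hζ | hζ)
    · exact hCC' ζ hζ ▸ hC.isUnit hζ
    · exact ContinuousLinearMap.isUnit_iff_bijective.mpr (hbij ζ hζ)
  refine exists_analyticOnNhd_of_star_add_eq_one hO (fun ζ => hR.differentiableAt)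
    (fun ζ => hR.star_add) (continuousOn_inverse_one_sub_smul_VC hV hz h0 hc hnorm hunit)
    (fun ζ hζ => ?_) fun ζ hζ => ?_
  · simp only [hCC' ζ hζ, hC.inverse_eq hζ]
  · have hζ1 := inv_conj_eq_self (mem_sphere_zero_iff_norm.mp hζ.1)
    have hu := hunit ζ (Or.inr hζ)
    have hW : star (Vplus hV hz (C' ζ)) * Vplus hV hz (C' ζ) = 1 :=
      (ContinuousLinearMap.norm_map_iff_adjoint_comp_self _).mp
        ((norm_Vplus_apply_iff hV hz h0).mpr (hiso ζ hζ))
    have hVC : star (VC hV hz (C' ζ)) * VC hV hz (C' ζ) = 1 := star_mobius_mul_self hW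
      (isUnit_one_add_smul_Vplus hV hz h0 (hnorm ζ (Or.inr hζ)))
    simpa only [hζ1] using star_inverse_add_inverse_one_sub_smul hVC
      (ne_of_mem_sphere hζ.1 one_ne_zero) hu (hζ1.symm ▸ hu)

end Inin

theorem IsOpenArc.exists_isOpen {Δ : Set ℂ} (hΔ : IsOpenArc Δ) :
    ∃ O, IsOpen O ∧ Δ = sphere 0 1 ∩ O := by
  obtain ⟨a, b, -, rfl⟩ := hΔ
  refine ⟨Complex.exp '' {w | w.im ∈ Ioo a b},
    isOpenMap_exp _ (isOpen_Ioo.preimage continuous_im), ?_⟩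
  ext ζ
  constructor
  · rintro ⟨θ, hθ, rfl⟩
    exact ⟨by simp, θ * I, by simpa using hθ, rfl⟩
  · rintro ⟨hζ, w, hw, rfl⟩
    rw [mem_sphere_zero_iff_norm, norm_exp, Real.exp_eq_one_iff] at hζ
    exact ⟨w.im, hw, congrArg Complex.exp (Complex.ext (by simp [hζ]) (by simp))⟩

end GenRes

theorem theorem3p2_general {H : Type u} [NormedAddCommGroup H] [InnerProductSpace ℂ H]
    [CompleteSpace H]
    (V : H →ₗ.[ℂ] H) (hV : GenRes.IsClosedIsometric V)
    (z₀ : ℂ) (hz₀ : ‖z₀‖ < 1) (hz₀' : z₀ ≠ 0)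
    (R : ℂ → (H →L[ℂ] H)) (hR : GenRes.IsGeneralizedResolvent.{u, v} V R)
    (C : ℂ → (GenRes.N V z₀ →L[ℂ] GenRes.N V (conj z₀)⁻¹))
    (hC : GenRes.IninCorresponds hV hz₀ R C)
    (O : Set ℂ) (hO : IsOpen O) :
    GenRes.HasAnalyticContinuation R (sphere 0 1 ∩ O) ↔
      ∃ C' : ℂ → (GenRes.N V z₀ →L[ℂ] GenRes.N V (conj z₀)⁻¹),
        (∀ ζ ∈ ball (0 : ℂ) 1, C' ζ = C ζ) ∧
        ContinuousOn C' (ball (0 : ℂ) 1 ∪ sphere 0 1 ∩ O) ∧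
        (∀ ζ ∈ sphere (0 : ℂ) 1 ∩ O, (∀ x, ‖C' ζ x‖ = ‖x‖) ∧ Function.Surjective (C' ζ)) ∧
        (∀ ζ ∈ sphere (0 : ℂ) 1 ∩ O,
          Function.Bijective (1 - ζ • GenRes.VC hV hz₀ (C' ζ) : H →L[ℂ] H)) := by
  constructor
  · exact hC.exists_extension hz₀' hR inter_subset_left
  · rintro ⟨C', hCC', hc, hiso, hbij⟩
    exact hC.hasAnalyticContinuation hz₀' hR hO hCC' hc (fun ζ hζ => (hiso ζ hζ).1) hbij

theorem theorem3p2 {H : Type u} [NormedAddCommGroup H] [InnerProductSpace ℂ H]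
    [CompleteSpace H]
    (V : H →ₗ.[ℂ] H) (hV : GenRes.IsClosedIsometric V)
    (z₀ : ℂ) (hz₀ : ‖z₀‖ < 1) (hz₀' : z₀ ≠ 0)
    (R : ℂ → (H →L[ℂ] H)) (hR : GenRes.IsGeneralizedResolvent.{u, v} V R)
    (C : ℂ → (GenRes.N V z₀ →L[ℂ] GenRes.N V (conj z₀)⁻¹))
    (hC : GenRes.IninCorresponds hV hz₀ R C)
    (Δ : Set ℂ) (hΔ : GenRes.IsOpenArc Δ) :
    GenRes.HasAnalyticContinuation R Δ ↔
      ∃ C' : ℂ → (GenRes.N V z₀ →L[ℂ] GenRes.N V (conj z₀)⁻¹),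
        (∀ ζ ∈ ball (0 : ℂ) 1, C' ζ = C ζ) ∧
        ContinuousOn C' (ball (0 : ℂ) 1 ∪ Δ) ∧
        (∀ ζ ∈ Δ, (∀ x, ‖C' ζ x‖ = ‖x‖) ∧ Function.Surjective (C' ζ)) ∧
        (∀ ζ ∈ Δ, Function.Bijective (1 - ζ • GenRes.VC hV hz₀ (C' ζ) : H →L[ℂ] H)) := by
  obtain ⟨O, hO, rfl⟩ := hΔ.exists_isOpen
  exact theorem3p2_general V hV z₀ hz₀ hz₀' R hR C hC O hO
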